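/- Let $(T,\mu,\eta)$ be a monad and $F$ an endofunctor on a category $\mathcal C$, and let $\alpha$ be an ordinal. Regard $\{\beta\mid\beta\le\alpha\}$ (the frame of down-sets of $\alpha$) as a site in which a sieve covers $\beta$ iff the least upper bound of its members is $\beta$, and let $\mathrm{Sh}_{\mathcal C}(\alpha)$ be the category of $\mathcal C$-valued sheaves on it, with inclusion $i$ into presheaves. Assume that $i$ has a left adjoint $a$ and that the constant sheaf functor $\Delta=a\circ\mathrm{const}\colon\mathcal C\to\mathrm{Sh}_{\mathcal C}(\alpha)$ has a right adjoint $\Gamma$ (so that $\Delta\dashv\Gamma$ is defined). For $E\colon\mathcal C\to\mathcal C$ let $\underline{E}$ be the pointwise extension $X\mapsto a(E\circ iX)$; then canonically $\underline{E'}\,\underline{E}\cong\underline{E'E}$ and $\mathrm{Id}\cong\underline{\mathrm{Id}}$, and $\underline{T}$ is a monad on $\mathrm{Sh}_{\mathcal C}(\alpha)$. Let $p(\beta)=\bigvee\{\gamma+1\mid\gamma+1<\beta\}$, let $\blacktriangleright X=a(iX\circ p)$, let $\mathrm{next}\colon\mathrm{Id}\Rightarrow\blacktriangleright$ be given by restriction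 along $p(\beta)\le\beta$ followed by the unit of $a\dashv i$, and let $G=\underline{F}\circ\blacktriangleright$ be the guarded pointwise extension of $F$. A final sequence of $F$ is a limit-preserving functor $f\colon\mathrm{Ord}^{\mathrm{op}}\to\mathcal C$ (so $f(0)$ is terminal and $f(\lambda)=\lim_{\beta<\lambda}f(\beta)$ for limit $\lambda$) with $f(\beta+1)\cong F f(\beta)$ naturally in $\beta$; it is stable at $\alpha$ if $f(\alpha+1)\to f(\alpha)$ is an isomorphism. Suppose that $F$ has a final sequence $f$ that is stable at $\alpha$, and let $\mathrm{fseq}(F)\in\mathrm{Sh}_{\mathcal C}(\alpha)$ be its restriction to $\{\beta\le\alpha\}$. Let $K\colon\mathrm{Sh}_{\mathcal C}(\alpha)\to\mathrm{Kl}(\underline{T})$ be the canonical functor and let $\overline{G}$ be a Kleisli lifting of $G$, i.e. an endofunctor of $\mathrm{Kl}(\underline{T})$ with $\overline{G}K\cong KG$. Then there is an isomorphism $c\colon\mathrm{fseq}(F)\cong G(\mathrm{fseq}(F))$ which at each stage $\beta+1\le\alpha$ is the canonical identification $f(\beta+1)\cong F f(\beta)=F f(p(\beta+1))$ followed by the canonical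 map $F f(p(\beta+1))\to G(\mathrm{fseq}(F))(\beta+1)$ (units of $a\dashv i$), such that: 1. $(\mathrm{fseq}(F),c)$ is a final $G$-coalgebra; 2. its image under $K$, namely $K\,\mathrm{fseq}(F)$ with structure $K\,\mathrm{fseq}(F)\xrightarrow{Kc}KG\,\mathrm{fseq}(F)\cong\overline{G}K\,\mathrm{fseq}(F)$, is a final $\overline{G}$-coalgebra; hence the final $\overline{G}$-coalgebra captures (possibly) infinite trace semantics, meaning that final coalgebras $\nu G$ and $\nu\overline{G}$ exist and $\nu\overline{G}\cong K(\nu G)$; 3. $f(\alpha)$, with the structure $f(\alpha)\cong f(\alpha+1)\cong F f(\alpha)$, is a final $F$-coalgebra, and $\Gamma(\mathrm{fseq}(F))\cong f(\alpha)$; 4. every $TF$-coalgebra $h\colon X\to TFX$ has an infinite trace semantics: there is exactly one $\overline{G}$-coalgebra homomorphism from the $\overline{G}$-coalgebra on $\Delta X$ induced by $\Delta X\xrightarrow{\Delta h}\Delta TFX\to\underline{TF}\,\Delta X\xrightarrow{\underline{TF}(\mathrm{next}_{\Delta X})}\underline{TF}\,{\blacktriangleright}\Delta X\cong\underline{T}\,G\,\Delta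 X$ to the final $\overline{G}$-coalgebra of (2). -/

import Mathlib

open CategoryTheory Opposite

universe w v u

namespace GuardedTrace

/-- The sup topology on a linear order: a sieve covers a stage `a` when `a` is the least upper bound
of the stages that it contains. For the frame of opens of an ordinal this is the canonical
topology. -/
def supTopology (P : Type u) [LinearOrder P] : GrothendieckTopology P where
  sieves a := {S | IsLUB {b | ∃ f : b ⟶ a, S f} a}
  top_mem' a := ⟨fun _ ⟨f, _⟩ => leOfHom f, fun _ h => h ⟨𝟙 a, trivial⟩⟩
  pullback_stable' a c S f hS := by
    refine ⟨fun _ ⟨g, _⟩ => leOfHom g, fun x hx => ?_⟩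
    rcases (leOfHom f).eq_or_lt with rfl | hlt
    · exact hS.2 fun b ⟨g, hg⟩ => hx ⟨g, by
        change S (g ≫ f)
        rwa [Subsingleton.elim (g ≫ f) g]⟩
    · obtain ⟨b, ⟨g, hg⟩, hb⟩ := (lt_isLUB_iff hS).1 hlt
      refine hx ⟨𝟙 c, ?_⟩
      change S (𝟙 c ≫ f)
      rw [Subsingleton.elim (𝟙 c ≫ f) (homOfLE hb.le ≫ g)]
      exact S.downward_closed hg _
  transitive' a S hS R hR := by
    refine ⟨fun _ ⟨g, _⟩ => leOfHom g, fun x hx => hS.2 fun b ⟨g, hg⟩ => ?_⟩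
    exact (hR hg).2 fun c ⟨k, hk⟩ => hx ⟨k ≫ g, hk⟩

/-- The opens of an ordinal `α` with its Alexandrov topology are its down-sets, that is, the ordinals
`β ≤ α`. -/
abbrev Stage (α : Ordinal.{w}) : Type (w + 1) := Set.Iic α

/-- The site of opens of `α`. -/
noncomputable abbrev alexandrov (α : Ordinal.{w}) : GrothendieckTopology (Stage α) :=
  supTopology (Stage α)

/-- The members of the base of successor ordinals strictly below `a`. -/
def succsBelow (a : Ordinal.{w}) : Set Ordinal.{w} := {b | b < a ∧ ∃ β : Ordinal.{w}, b = β + 1}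

theorem mem_upperBounds_succsBelow (a : Ordinal.{w}) : a ∈ upperBounds (succsBelow a) :=
  fun _ h => le_of_lt h.1

/-- The predecessor of a stage: the join of the base opens (successor ordinals) strictly below it. -/
noncomputable def predecessor (α : Ordinal.{w}) : Stage α →o Stage α where
  toFun a := ⟨sSup (succsBelow a.1),
    (csSup_le' (mem_upperBounds_succsBelow a.1)).trans a.2⟩
  monotone' _ b h := csSup_le_csSup' ⟨b.1, mem_upperBounds_succsBelow b.1⟩
    fun _ hc => ⟨lt_of_lt_of_le hc.1 h, hc.2⟩

theorem predecessor_le {α : Ordinal.{w}} (a : Stage α) : predecessor α a ≤ a :=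
  csSup_le' (mem_upperBounds_succsBelow a.1)

theorem predecessor_succ {α β : Ordinal.{w}} (h : β + 1 ≤ α) :
    (predecessor α ⟨β + 1, h⟩).1 = β := by
  apply le_antisymm
  · refine csSup_le' fun b hb => ?_
    exact Order.lt_add_one_iff.1 hb.1
  · refine le_of_forall_lt fun c hc => ?_
    refine lt_of_lt_of_le (Order.lt_add_one_iff.2 le_rfl : c < c + 1)
      (le_csSup ⟨β + 1, mem_upperBounds_succsBelow _⟩ ⟨?_, c, rfl⟩)
    exact lt_of_le_of_lt (Order.add_one_le_of_lt hc) (Order.lt_add_one_iff.2 le_rfl)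

variable {C : Type u} [Category.{v} C]

/-- `C`-valued sheaves on the ordinal `α`. -/
abbrev Sh (C : Type u) [Category.{v} C] (α : Ordinal.{w}) := Sheaf (alexandrov α) C

/-- The stages that are successor ordinals. -/
def IsSuccStage (α : Ordinal.{w}) : ObjectProperty (Stage α) := fun s => ∃ β, s.1 = β + 1

theorem mem_of_cover {α : Ordinal.{w}} {s t : Stage α} (hs : IsSuccStage α s) (h : s ⟶ t)
    {S : Sieve t} (hS : S ∈ alexandrov α t) : S h := by
  obtain ⟨β, hβ⟩ := hs
  have hlt : β < t.1 := lt_of_lt_of_le (by simp [hβ]) (leOfHom h)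
  let b : Stage α := ⟨β, hlt.le.trans t.2⟩
  obtain ⟨c, ⟨g, hg⟩, hc⟩ := (lt_isLUB_iff (b := b) hS).1 hlt
  have hsc : s ≤ c := by
    change s.1 ≤ c.1
    rw [hβ]
    exact Order.add_one_le_of_lt hc
  rw [Subsingleton.elim h (homOfLE hsc ≫ g)]
  exact S.downward_closed hg _

instance (α : Ordinal.{w}) : (IsSuccStage α).ι.IsCoverDense (alexandrov α) where
  is_cover t := by
    refine ⟨fun _ ⟨g, _⟩ => leOfHom g, fun x hx => ?_⟩
    by_contra hlt
    rw [not_le] at hlt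
    let s : (IsSuccStage α).FullSubcategory :=
      ⟨⟨x.1 + 1, (Order.add_one_le_of_lt (show x.1 < t.1 from hlt)).trans t.2⟩, x.1, rfl⟩
    have hlt' : x.1 < t.1 := hlt
    have hst : s.obj ≤ t := show x.1 + 1 ≤ t.1 from Order.add_one_le_of_lt hlt'
    have := hx ⟨homOfLE hst, Presieve.in_coverByImage (IsSuccStage α).ι (Y := s) (homOfLE hst)⟩
    exact absurd this (not_le.2 (Order.lt_add_one_iff.2 le_rfl : x.1 < x.1 + 1))

theorem isIso_map_of_succ {α : Ordinal.{w}} [HasWeakSheafify (alexandrov α) C]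
    {P Q : (Stage α)ᵒᵖ ⥤ C} (f : P ⟶ Q) (hf : ∀ s, IsSuccStage α s → IsIso (f.app (op s))) :
    IsIso ((presheafToSheaf (alexandrov α) C).map f) := by
  rw [← GrothendieckTopology.W_iff]
  intro X hX
  have : IsIso (Functor.whiskerLeft (IsSuccStage α).ι.op f) := by
    have : ∀ s, IsIso ((Functor.whiskerLeft (IsSuccStage α).ι.op f).app s) :=
      fun s => hf _ s.unop.property
    exact NatIso.isIso_of_isIso_app _
  have key : ∀ (R : (Stage α)ᵒᵖ ⥤ C), Function.Bijective
      (fun g : R ⟶ X => Functor.whiskerLeft (IsSuccStage α).ι.op g) := fun R =>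
    (Functor.IsCoverDense.restrictHomEquivHom (G := (IsSuccStage α).ι) (ℱ := R)
      (ℱ' := (⟨X, hX⟩ : Sh C α))).symm.bijective
  rw [← Function.Bijective.of_comp_iff' (key P)]
  have h2 : Function.Bijective (fun g : (IsSuccStage α).ι.op ⋙ Q ⟶ (IsSuccStage α).ι.op ⋙ X =>
      Functor.whiskerLeft (IsSuccStage α).ι.op f ≫ g) :=
    ⟨fun g h e => (cancel_epi _).1 e, fun g => ⟨inv (Functor.whiskerLeft _ f) ≫ g, by simp⟩⟩
  exact h2.comp (key Q)

theorem hasTerminal_of_sheaf {α : Ordinal.{w}} (X : Sh C α) : Limits.HasTerminal C := by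
  let z : Stage α := ⟨0, Set.mem_Iic.2 zero_le⟩
  have hz : (⊥ : Sieve z) ∈ alexandrov α z := by
    refine ⟨fun _ ⟨g, hg⟩ => hg.elim, fun x _ => ?_⟩
    exact (zero_le : (0 : Ordinal.{w}) ≤ x.1)
  exact (X.isTerminalOfBotCover z hz).hasTerminal

section
variable {P : Type*} [Category P] [∀ a b : Pᵒᵖ, Limits.HasProductsOfShape (a ⟶ b) C]

/-- The projections of the right adjoint to evaluation at `s`. -/
noncomputable def skyProj (s : P) (c : C) {t : P} (g : s ⟶ t) :
    ((evaluationRightAdjoint C (op s)).obj c).obj (op t) ⟶ c :=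
  Limits.Pi.π (fun _ : op t ⟶ op s => c) g.op

/-- The tupling for the right adjoint to evaluation at `s`. -/
noncomputable def skyLift (s : P) (c : C) {t : P} {X : C} (q : (s ⟶ t) → (X ⟶ c)) :
    X ⟶ ((evaluationRightAdjoint C (op s)).obj c).obj (op t) :=
  Limits.Pi.lift (fun g : op t ⟶ op s => q g.unop)

theorem skyLift_proj (s : P) (c : C) {t : P} {X : C} (q : (s ⟶ t) → (X ⟶ c)) (g : s ⟶ t) :
    skyLift s c q ≫ skyProj s c g = q g :=
  Limits.Pi.lift_π (fun g : op t ⟶ op s => q g.unop) g.op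

theorem sky_ext {s : P} {c : C} {t : P} {X : C}
    {k l : X ⟶ ((evaluationRightAdjoint C (op s)).obj c).obj (op t)}
    (h : ∀ g : s ⟶ t, k ≫ skyProj s c g = l ≫ skyProj s c g) : k = l :=
  Limits.Pi.hom_ext (f := fun _ : op t ⟶ op s => c) k l fun g => h g.unop

theorem sky_map (s : P) (c : C) {t t' : P} (f : t ⟶ t') (g : s ⟶ t) :
    ((evaluationRightAdjoint C (op s)).obj c).map f.op ≫ skyProj s c g = skyProj s c (g ≫ f) :=
  Limits.Pi.lift_π (fun g : op t ⟶ op s =>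
    Limits.Pi.π (fun _ : op t' ⟶ op s => c) (f.op ≫ g)) g.op

end

theorem isIso_toSheafify_app {α : Ordinal.{w}} [HasWeakSheafify (alexandrov α) C]
    (P : (Stage α)ᵒᵖ ⥤ C) {s : Stage α} (hs : IsSuccStage α s) :
    IsIso ((toSheafify (alexandrov α) P).app (op s)) := by
  have := hasTerminal_of_sheaf ((presheafToSheaf (alexandrov α) C).obj P)
  have (a b : (Stage α)ᵒᵖ) : Limits.HasProductsOfShape (a ⟶ b) C := by
    rcases isEmpty_or_nonempty (a ⟶ b) with h | h
    · exact Limits.hasLimitsOfShape_of_equivalence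
        (Discrete.equivalence (Equiv.equivPEmpty (a ⟶ b))).symm
    · obtain ⟨f⟩ := h
      have : Unique (a ⟶ b) := ⟨⟨f⟩, fun _ => Subsingleton.elim _ _⟩
      exact ⟨fun K => Limits.hasLimit_of_iso Discrete.natIsoFunctor.symm⟩
  let adj := evaluationAdjunctionLeft C (op s)
  have hR (c : C) : Presheaf.IsSheaf (alexandrov α) ((evaluationRightAdjoint C (op s)).obj c) := by
    intro E t S hS x hx
    refine ⟨skyLift s c fun g => x g (mem_of_cover hs g hS) ≫ skyProj s c (𝟙 s), ?_, ?_⟩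
    · intro V f hf
      change skyLift s c _ ≫ ((evaluationRightAdjoint C (op s)).obj c).map f.op = x f hf
      refine sky_ext fun g => ?_
      have h : x (g ≫ f) _ ≫ ((evaluationRightAdjoint C (op s)).obj c).map (𝟙 s).op =
          x f hf ≫ ((evaluationRightAdjoint C (op s)).obj c).map g.op :=
        hx (𝟙 s) g (mem_of_cover hs (g ≫ f) hS) hf (by simp)
      rw [op_id, CategoryTheory.Functor.map_id, Category.comp_id] at h
      rw [Category.assoc, sky_map, skyLift_proj, h, Category.assoc, sky_map, Category.id_comp]
    · intro y hy
      refine sky_ext fun g => ?_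
      have h : y ≫ ((evaluationRightAdjoint C (op s)).obj c).map g.op = x g _ :=
        hy g (mem_of_cover hs g hS)
      rw [skyLift_proj, ← h, Category.assoc, sky_map, Category.id_comp]
  rw [isIso_iff_coyoneda_map_bijective]
  intro c
  have h1 := (alexandrov α).W_toSheafify P _ (hR c)
  have h2 := ((adj.homEquiv P c).symm.bijective.comp h1).comp (adj.homEquiv _ c).bijective
  refine (congrArg Function.Bijective (funext fun g => ?_)).mpr h2
  change _ = (adj.homEquiv P c).symm (toSheafify (alexandrov α) P ≫ adj.homEquiv _ c g)
  rw [Adjunction.homEquiv_naturality_left_symm]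
  simp


instance isIso_map_toSheafify {α : Ordinal.{w}} [HasWeakSheafify (alexandrov α) C]
    (P : (Stage α)ᵒᵖ ⥤ C) (F : C ⥤ C) :
    IsIso ((presheafToSheaf (alexandrov α) C).map
      (Functor.whiskerRight (toSheafify (alexandrov α) P) F)) :=
  isIso_map_of_succ _ fun s hs => by
    have := isIso_toSheafify_app P hs
    exact inferInstanceAs (IsIso (F.map ((toSheafify (alexandrov α) P).app (op s))))


section Extension

variable {α : Ordinal.{w}} [HasWeakSheafify (alexandrov α) C]

/-- The pointwise extension of an endofunctor `F` to sheaves: apply `F` at every stage and sheafify. -/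
noncomputable def extP (F : C ⥤ C) (α : Ordinal.{w}) [HasWeakSheafify (alexandrov α) C] :
    Sh C α ⥤ Sh C α :=
  sheafToPresheaf _ _ ⋙ (Functor.whiskeringRight _ _ _).obj F ⋙ presheafToSheaf _ _

/-- The pointwise extension of a natural transformation. -/
noncomputable def extPMap {F F' : C ⥤ C} (σ : F ⟶ F') (α : Ordinal.{w})
    [HasWeakSheafify (alexandrov α) C] : extP F α ⟶ extP F' α :=
  Functor.whiskerLeft (sheafToPresheaf _ _)
    (Functor.whiskerRight ((Functor.whiskeringRight _ _ _).map σ) (presheafToSheaf _ _))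

/-- For a presheaf `P`, the comparison of the sheafification of `P ⋙ F` with the pointwise extension
of `F` at the sheafification of `P`. -/
noncomputable def extPUnit (P : (Stage α)ᵒᵖ ⥤ C) (F : C ⥤ C) :
    (presheafToSheaf (alexandrov α) C).obj (P ⋙ F) ⟶
      (extP F α).obj ((presheafToSheaf (alexandrov α) C).obj P) :=
  (presheafToSheaf (alexandrov α) C).map
    (Functor.whiskerRight (toSheafify (alexandrov α) P) F)

/-- `extPUnit` is an isomorphism, because the unit of sheafification is one at successor stages. -/
noncomputable def extPUnitIso (P : (Stage α)ᵒᵖ ⥤ C) (F : C ⥤ C) :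
    (presheafToSheaf (alexandrov α) C).obj (P ⋙ F) ≅
      (extP F α).obj ((presheafToSheaf (alexandrov α) C).obj P) :=
  have : IsIso (extPUnit P F) := isIso_map_toSheafify P F
  asIso (extPUnit P F)

theorem extPUnit_naturality {P Q : (Stage α)ᵒᵖ ⥤ C} (f : P ⟶ Q) (F : C ⥤ C) :
    extPUnit P F ≫ (extP F α).map ((presheafToSheaf (alexandrov α) C).map f) =
      (presheafToSheaf (alexandrov α) C).map (Functor.whiskerRight f F) ≫ extPUnit Q F := by
  refine (Functor.map_comp _ _ _).symm.trans (Eq.trans ?_ (Functor.map_comp _ _ _))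
  refine congrArg _ ?_
  refine (Functor.whiskerRight_comp _ _ _).symm.trans (Eq.trans ?_ (Functor.whiskerRight_comp _ _ _))
  exact congrArg (fun k => Functor.whiskerRight k F) (toSheafify_naturality (alexandrov α) f).symm

theorem extPUnit_natural {F F' : C ⥤ C} (σ : F ⟶ F') (P : (Stage α)ᵒᵖ ⥤ C) :
    extPUnit P F ≫ (extPMap σ α).app ((presheafToSheaf (alexandrov α) C).obj P) =
      (presheafToSheaf (alexandrov α) C).map (Functor.whiskerLeft P σ) ≫ extPUnit P F' := by
  refine (Functor.map_comp _ _ _).symm.trans (Eq.trans ?_ (Functor.map_comp _ _ _))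
  refine congrArg _ ?_
  ext s
  exact (σ.naturality _)

/-- Pointwise extension respects composition up to canonical isomorphism. -/
noncomputable def extPComp (F F' : C ⥤ C) (α : Ordinal.{w}) [HasWeakSheafify (alexandrov α) C] :
    extP F' α ⋙ extP F α ≅ extP (F' ⋙ F) α :=
  (NatIso.ofComponents (F := extP (F' ⋙ F) α) (G := extP F' α ⋙ extP F α)
    (fun X => extPUnitIso (X.obj ⋙ F') F)
    (fun {X Y} (f : X ⟶ Y) => (extPUnit_naturality (Functor.whiskerRight f.hom F') F).symm)).symm

/-- Pointwise extension respects the identity up to canonical isomorphism. -/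
noncomputable def extPId (α : Ordinal.{w}) [HasWeakSheafify (alexandrov α) C] :
    𝟭 (Sh C α) ≅ extP (𝟭 C) α :=
  (asIso (sheafificationAdjunction (alexandrov α) C).counit).symm

theorem extPId_app (P : (Stage α)ᵒᵖ ⥤ C) :
    (extPId α).hom.app ((presheafToSheaf (alexandrov α) C).obj P) =
      (presheafToSheaf (alexandrov α) C).map (toSheafify (alexandrov α) P) := by
  have h := (sheafificationAdjunction (alexandrov α) C).left_triangle_components P
  have h' := congrArg (fun k => k ≫ (extPId α).hom.app _) h
  have e : (sheafificationAdjunction (alexandrov α) C).counit.app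
      ((presheafToSheaf (alexandrov α) C).obj P) ≫ (extPId α).hom.app _ = 𝟙 _ :=
    (extPId (C := C) α).inv_hom_id_app _
  refine (Category.id_comp _).symm.trans (h'.symm.trans ?_)
  refine (Category.assoc _ _ _).trans ?_
  exact (congrArg _ e).trans (Category.comp_id _)

theorem extPUnit_counit (X : Sh C α) (F : C ⥤ C) :
    extPUnit X.obj F ≫ (extP F α).map ((extPId α).inv.app X) = 𝟙 _ := by
  have h := (sheafificationAdjunction (alexandrov α) C).right_triangle_components X
  refine (Functor.map_comp _ _ _).symm.trans (Eq.trans ?_ (CategoryTheory.Functor.map_id _ _))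
  refine congrArg _ ?_
  refine (Functor.whiskerRight_comp _ _ _).symm.trans (Eq.trans ?_ (Functor.whiskerRight_id' F))
  exact congrArg (fun k => Functor.whiskerRight k F) h

/-- The unit of the pointwise extension of a monad. -/
noncomputable def extPη (T : Monad C) (α : Ordinal.{w}) [HasWeakSheafify (alexandrov α) C] :
    𝟭 (Sh C α) ⟶ extP T.toFunctor α :=
  (extPId α).hom ≫ extPMap T.η α

/-- The multiplication of the pointwise extension of a monad. -/
noncomputable def extPμ (T : Monad C) (α : Ordinal.{w}) [HasWeakSheafify (alexandrov α) C] :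
    extP T.toFunctor α ⋙ extP T.toFunctor α ⟶ extP T.toFunctor α :=
  (extPComp T.toFunctor T.toFunctor α).hom ≫ extPMap T.μ α

theorem extPUnit_μ (T : Monad C) (X : Sh C α) :
    extPUnit (X.obj ⋙ T.toFunctor) T.toFunctor ≫ (extPμ T α).app X =
      (presheafToSheaf (alexandrov α) C).map (Functor.whiskerLeft X.obj T.μ) := by
  have e : extPUnit (X.obj ⋙ T.toFunctor) T.toFunctor ≫
      (extPComp T.toFunctor T.toFunctor α).hom.app X = 𝟙 _ :=
    (extPComp T.toFunctor T.toFunctor α).inv_hom_id_app X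
  refine (Category.assoc _ _ _).symm.trans ?_
  rw [e]
  exact Category.id_comp _

theorem extP_cancel {P : (Stage α)ᵒᵖ ⥤ C} {F : C ⥤ C} {Y : Sh C α}
    {f g : (extP F α).obj ((presheafToSheaf (alexandrov α) C).obj P) ⟶ Y}
    (h : extPUnit P F ≫ f = extPUnit P F ≫ g) : f = g :=
  have : IsIso (extPUnit P F) := isIso_map_toSheafify P F
  (cancel_epi (extPUnit P F)).1 h

theorem chase_assoc {D : Type*} [Category D] {A B B' G Z H K : D} {w₁ : A ⟶ B} {w₂ : B ⟶ B'}
    {m₁ : B' ⟶ G} {n₁ : B' ⟶ G} {m : G ⟶ Z} {k : B ⟶ G} {p q : A ⟶ H} {w : H ⟶ G} {r : H ⟶ Z}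
    {x : A ⟶ K} {y : K ⟶ B'} {z : K ⟶ G} (e₁ : w₂ ≫ m₁ = k) (e₂ : w₁ ≫ k = p ≫ w)
    (e₃ : w₁ ≫ w₂ = x ≫ y) (e₄ : w ≫ m = r) (e₅ : y ≫ n₁ = z) (e₆ : x ≫ z = q ≫ w)
    (e₇ : p ≫ r = q ≫ r) : w₁ ≫ w₂ ≫ m₁ ≫ m = w₁ ≫ w₂ ≫ n₁ ≫ m := by
  rw [reassoc_of% e₁, reassoc_of% e₂, e₄, e₇, reassoc_of% e₃, reassoc_of% e₅, reassoc_of% e₆, e₄]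

theorem chase_unit {D : Type*} [Category D] {A B G Z H : D} {w : A ⟶ B} {i : B ⟶ Z}
    {h : Z ⟶ G} {m : G ⟶ Z} {k : B ⟶ G} {p : A ⟶ H} {w' : H ⟶ G} {r : H ⟶ Z} {d : A ⟶ Z}
    (e₁ : i ≫ h = k) (e₂ : w ≫ k = p ≫ w') (e₃ : w' ≫ m = r) (e₄ : p ≫ r = d)
    (e₅ : w ≫ i = d) : w ≫ i ≫ h ≫ m = w ≫ i ≫ 𝟙 Z := by
  rw [reassoc_of% e₁, reassoc_of% e₂, e₃, e₄, Category.comp_id, e₅]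

theorem extPMonad_assoc (T : Monad C) (X : Sh C α) :
    (extP T.toFunctor α).map ((extPμ T α).app X) ≫ (extPμ T α).app X =
      (extPμ T α).app ((extP T.toFunctor α).obj X) ≫ (extPμ T α).app X := by
  let a := presheafToSheaf (alexandrov α) C
  let t := T.toFunctor
  let E := extP t α
  let P := X.obj
  have hE : Epi (E.map (extPUnit (P ⋙ t) t)) :=
    inferInstanceAs (Epi (E.mapIso (extPUnitIso (P ⋙ t) t)).hom)
  refine hE.left_cancellation _ _ (extP_cancel ?_)
  have e1 : E.map (extPUnit (P ⋙ t) t) ≫ E.map ((extPμ T α).app X) =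
      E.map (a.map (Functor.whiskerLeft P T.μ)) :=
    (E.map_comp _ _).symm.trans (congrArg _ (extPUnit_μ T X))
  have e2 : extPUnit ((P ⋙ t) ⋙ t) t ≫ E.map (a.map (Functor.whiskerLeft P T.μ)) =
      a.map (Functor.whiskerRight (Functor.whiskerLeft P T.μ) t) ≫ extPUnit (P ⋙ t) t :=
    extPUnit_naturality _ _
  have e3 : extPUnit ((P ⋙ t) ⋙ t) t ≫ E.map (extPUnit (P ⋙ t) t) =
      a.map (Functor.whiskerRight (Functor.whiskerRight (toSheafify (alexandrov α) (P ⋙ t)) t) t) ≫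
        extPUnit ((a.obj (P ⋙ t)).obj ⋙ t) t :=
    extPUnit_naturality _ _
  have e4 := extPUnit_μ T X
  have e5 : extPUnit ((a.obj (P ⋙ t)).obj ⋙ t) t ≫ (extPμ T α).app (E.obj X) =
      a.map (Functor.whiskerLeft (a.obj (P ⋙ t)).obj T.μ) := extPUnit_μ T (E.obj X)
  have e6 : Functor.whiskerRight (Functor.whiskerRight
        (toSheafify (alexandrov α) (P ⋙ t)) t) t ≫
        Functor.whiskerLeft (a.obj (P ⋙ t)).obj T.μ =
      Functor.whiskerLeft (P ⋙ t) T.μ ≫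
        Functor.whiskerRight (toSheafify (alexandrov α) (P ⋙ t)) t := by
    ext s
    exact T.μ.naturality _
  have e7 : Functor.whiskerRight (Functor.whiskerLeft P T.μ) t ≫ Functor.whiskerLeft P T.μ =
      Functor.whiskerLeft (P ⋙ t) T.μ ≫ Functor.whiskerLeft P T.μ := by
    ext s
    exact T.assoc _
  exact chase_assoc e1 e2 e3 e4 e5
    ((a.map_comp _ _).symm.trans ((congrArg _ e6).trans (a.map_comp _ _)))
    ((a.map_comp _ _).symm.trans ((congrArg _ e7).trans (a.map_comp _ _)))

theorem extPMonad_left_unit (T : Monad C) (X : Sh C α) :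
    (extPη T α).app ((extP T.toFunctor α).obj X) ≫ (extPμ T α).app X =
      𝟙 ((extP T.toFunctor α).obj X) := by
  let a := presheafToSheaf (alexandrov α) C
  let t := T.toFunctor
  let P := X.obj
  have e1 : (extPη T α).app ((extP t α).obj X) =
      a.map (Functor.whiskerLeft (P ⋙ t) T.η) ≫ extPUnit (P ⋙ t) t := by
    refine (congrArg (fun k => k ≫ (extPMap T.η α).app _) (extPId_app (P ⋙ t))).trans ?_
    exact extPUnit_natural T.η (P ⋙ t)
  have e2 : Functor.whiskerLeft (P ⋙ t) T.η ≫ Functor.whiskerLeft P T.μ = 𝟙 (P ⋙ t) := by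
    ext s
    exact T.left_unit _
  rw [e1]
  refine (Category.assoc _ _ _).trans ((congrArg _ (extPUnit_μ T X)).trans ?_)
  exact (a.map_comp _ _).symm.trans ((congrArg _ e2).trans (a.map_id _))

theorem extPMonad_right_unit (T : Monad C) (X : Sh C α) :
    (extP T.toFunctor α).map ((extPη T α).app X) ≫ (extPμ T α).app X =
      𝟙 ((extP T.toFunctor α).obj X) := by
  let a := presheafToSheaf (alexandrov α) C
  let t := T.toFunctor
  let E := extP t α
  let P := X.obj
  have hE : Epi (E.map ((extPId α).inv.app X)) :=
    inferInstanceAs (Epi (E.mapIso ((extPId α).app X).symm).hom)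
  refine hE.left_cancellation _ _ (extP_cancel (P := P) ?_)
  have e1 : E.map ((extPId α).inv.app X) ≫ E.map ((extPη T α).app X) =
      E.map (a.map (Functor.whiskerLeft P T.η)) := by
    refine (E.map_comp _ _).symm.trans (congrArg _ ?_)
    refine (Category.assoc _ _ _).symm.trans ?_
    refine (congrArg (fun k => k ≫ (extPMap T.η α).app X) ((extPId α).inv_hom_id_app X)).trans ?_
    exact Category.id_comp _
  have e2 : extPUnit P t ≫ E.map (a.map (Functor.whiskerLeft P T.η)) =
      a.map (Functor.whiskerRight (Functor.whiskerLeft P T.η) t) ≫ extPUnit (P ⋙ t) t :=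
    extPUnit_naturality (Functor.whiskerLeft P T.η) t
  have e3 : Functor.whiskerRight (Functor.whiskerLeft P T.η) t ≫ Functor.whiskerLeft P T.μ =
      𝟙 (P ⋙ t) := by
    ext s
    exact T.right_unit _
  exact chase_unit e1 e2 (extPUnit_μ T X)
    ((a.map_comp _ _).symm.trans ((congrArg _ e3).trans (a.map_id _))) (extPUnit_counit X t)

/-- The pointwise extension of a monad on `C` to a monad on sheaves. -/
noncomputable def extPMonad (T : Monad C) (α : Ordinal.{w}) [HasWeakSheafify (alexandrov α) C] :
    Monad (Sh C α) where
  toFunctor := extP T.toFunctor α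
  η := extPη T α
  μ := extPμ T α
  assoc X := extPMonad_assoc T X
  left_unit X := extPMonad_left_unit T X
  right_unit X := extPMonad_right_unit T X

/-- The later endofunctor: precompose with the predecessor and sheafify. -/
noncomputable def later (C : Type u) [Category.{v} C] (α : Ordinal.{w})
    [HasWeakSheafify (alexandrov α) C] : Sh C α ⥤ Sh C α :=
  sheafToPresheaf _ _ ⋙
    (Functor.whiskeringLeft _ _ _).obj (predecessor α).monotone.functor.op ⋙ presheafToSheaf _ _

/-- Restriction of a presheaf from each stage to its predecessor. -/
noncomputable def restrictPredecessor (P : (Stage α)ᵒᵖ ⥤ C) :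
    P ⟶ (predecessor α).monotone.functor.op ⋙ P where
  app s := P.map (homOfLE (predecessor_le s.unop)).op
  naturality _ _ _ := (P.map_comp _ _).symm.trans
    ((congrArg P.map (Subsingleton.elim _ _)).trans (P.map_comp _ _))

/-- The natural transformation from the identity to the later endofunctor, by restriction. -/
noncomputable def next (C : Type u) [Category.{v} C] (α : Ordinal.{w})
    [HasWeakSheafify (alexandrov α) C] : 𝟭 (Sh C α) ⟶ later C α where
  app X := ⟨restrictPredecessor X.obj ≫
    toSheafify (alexandrov α) ((predecessor α).monotone.functor.op ⋙ X.obj)⟩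
  naturality X Y f := by
    apply ObjectProperty.hom_ext
    have h : f.hom ≫ restrictPredecessor Y.obj = restrictPredecessor X.obj ≫
        Functor.whiskerLeft (predecessor α).monotone.functor.op f.hom := by
      ext s
      exact (f.hom.naturality _).symm
    have h' := toSheafify_naturality (alexandrov α)
      (Functor.whiskerLeft (predecessor α).monotone.functor.op f.hom)
    change f.hom ≫ restrictPredecessor Y.obj ≫ toSheafify _ _ =
      (restrictPredecessor X.obj ≫ toSheafify _ _) ≫ sheafifyMap _ _
    rw [reassoc_of% h, h', Category.assoc]
    rfl

/-- The guarded pointwise extension of `F`: the later endofunctor followed by the pointwise extension. -/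
noncomputable def guarded (F : C ⥤ C) (α : Ordinal.{w}) [HasWeakSheafify (alexandrov α) C] :
    Sh C α ⥤ Sh C α :=
  later C α ⋙ extP F α

/-- The canonical map from `F (X (p s))`, with `p` the predecessor, to the guarded pointwise extension
of `F` at `X`, both at stage `s`: the unit of sheafification is applied twice. -/
noncomputable def guardedUnit (F : C ⥤ C) (X : Sh C α) :
    ((predecessor α).monotone.functor.op ⋙ X.obj) ⋙ F ⟶ ((guarded F α).obj X).obj :=
  Functor.whiskerRight (toSheafify (alexandrov α) _) F ≫ toSheafify (alexandrov α) _

end Extension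

/-- A final sequence of `F`: a limit preserving functor from the opposite of the ordinals to `C` whose
value at `β + 1` is `F` of its value at `β` (and likewise on restriction maps). Limit preservation is
the sheaf condition for the sup topology: the value at `0` is terminal and the value at a limit
ordinal is the limit of the values below it. -/
structure FinalSequence (F : C ⥤ C) where
  seq : Ordinal.{w}ᵒᵖ ⥤ C
  isSheaf : Presheaf.IsSheaf (supTopology Ordinal.{w}) seq
  succIso (β : Ordinal.{w}) : seq.obj (op (β + 1)) ≅ F.obj (seq.obj (op β))
  succIso_naturality {β γ : Ordinal.{w}} (h : β ≤ γ) (h' : β + 1 ≤ γ + 1) :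
    seq.map (homOfLE h').op ≫ (succIso β).hom = (succIso γ).hom ≫ F.map (seq.map (homOfLE h).op)

namespace FinalSequence

variable {F : C ⥤ C} (Φ : FinalSequence.{w} F)

theorem le_add_one (α : Ordinal.{w}) : α ≤ α + 1 := by simp

/-- The final sequence is stable at `α` when its restriction from `α + 1` to `α` is an isomorphism. -/
def IsStableAt (α : Ordinal.{w}) : Prop :=
  IsIso (Φ.seq.map (homOfLE (le_add_one α)).op)

/-- The `F`-coalgebra carried by the value at `α` of a final sequence that is stable at `α`. -/
noncomputable def coalgebra (α : Ordinal.{w}) (h : Φ.IsStableAt α) : Endofunctor.Coalgebra F where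
  V := Φ.seq.obj (op α)
  str :=
    have : IsIso (Φ.seq.map (homOfLE (le_add_one α)).op) := h
    inv (Φ.seq.map (homOfLE (le_add_one α)).op) ≫ (Φ.succIso α).hom

/-- The inclusion of the stages of `α` into all ordinals. -/
def stageInclusion (α : Ordinal.{w}) : Stage α ⥤ Ordinal.{w} :=
  (Subtype.mono_coe (· ∈ Set.Iic α)).functor

theorem isSheaf_restrict (α : Ordinal.{w}) :
    Presheaf.IsSheaf (alexandrov α) ((stageInclusion α).op ⋙ Φ.seq) := by
  intro E t S hS
  let S' : Sieve t.1 :=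
    { arrows := fun b f => S (homOfLE (leOfHom f) : (⟨b, (leOfHom f).trans t.2⟩ : Stage α) ⟶ t)
      downward_closed := by
        intro b c f hf g
        exact S.downward_closed hf (homOfLE (leOfHom g) :
          (⟨c, (leOfHom (g ≫ f)).trans t.2⟩ : Stage α) ⟶ ⟨b, (leOfHom f).trans t.2⟩) }
  have hS' : S' ∈ supTopology Ordinal.{w} t.1 := by
    refine ⟨fun _ ⟨f, _⟩ => leOfHom f, fun x hx => ?_⟩
    by_contra hlt
    rw [not_le] at hlt
    have := hS.2 (show (⟨x, hlt.le.trans t.2⟩ : Stage α) ∈ _ from fun b ⟨g, hg⟩ =>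
      show b.1 ≤ x from hx ⟨homOfLE (show b.1 ≤ t.1 from leOfHom g), hg⟩)
    exact absurd (show t.1 ≤ x from this) (not_le.2 hlt)
  intro x hx
  let x' : Presieve.FamilyOfElements (Φ.seq ⋙ coyoneda.obj (op E)) S'.arrows :=
    fun b f hf => x (homOfLE (leOfHom f) : (⟨b, (leOfHom f).trans t.2⟩ : Stage α) ⟶ t) hf
  have hx' : x'.Compatible := by
    intro b c d g₁ g₂ f₁ f₂ h₁ h₂ _
    exact hx (Z := ⟨d, (leOfHom (g₁ ≫ f₁)).trans t.2⟩)
      (homOfLE (leOfHom g₁) : (⟨d, _⟩ : Stage α) ⟶ ⟨b, (leOfHom f₁).trans t.2⟩)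
      (homOfLE (leOfHom g₂) : (⟨d, _⟩ : Stage α) ⟶ ⟨c, (leOfHom f₂).trans t.2⟩) h₁ h₂
      (Subsingleton.elim _ _)
  obtain ⟨y, hy, hy'⟩ := Φ.isSheaf E S' hS' x' hx'
  exact ⟨y, fun b f hf => hy (homOfLE (show b.1 ≤ t.1 from leOfHom f)) hf,
    fun z hz => hy' z fun b f hf => hz _ hf⟩

/-- The sheaf on `α` given by a final sequence. -/
def sheaf (α : Ordinal.{w}) : Sh C α :=
  ⟨(stageInclusion α).op ⋙ Φ.seq, Φ.isSheaf_restrict α⟩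

/-- The identification, at stage `β + 1`, of the final sequence with `F` applied to its value at the
predecessor of that stage (which is `β`). -/
noncomputable def stageStr (α β : Ordinal.{w}) (h : β + 1 ≤ α) :
    (Φ.sheaf α).obj.obj (op ⟨β + 1, h⟩) ⟶
      (((predecessor α).monotone.functor.op ⋙ (Φ.sheaf α).obj) ⋙ F).obj (op ⟨β + 1, h⟩) :=
  (Φ.succIso β).hom ≫ F.map (Φ.seq.map (homOfLE (predecessor_succ h).le).op)

end FinalSequence

/-- A Kleisli lifting of an endofunctor `G` along a monad `T`: an endofunctor of the Kleisli category
that extends `G` along the canonical inclusion `K`. The comparison is an isomorphism; a strict lifting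
is the case of an identity. -/
structure KleisliLifting {D : Type*} [Category D] (T : Monad D) (G : D ⥤ D) where
  functor : Kleisli T ⥤ Kleisli T
  iso : Kleisli.Adjunction.toKleisli T ⋙ functor ≅ G ⋙ Kleisli.Adjunction.toKleisli T

namespace KleisliLifting

variable {D : Type*} [Category D] {T : Monad D} {G : D ⥤ D} (L : KleisliLifting T G)

/-- The image of a `G`-coalgebra under `K`. -/
def lift (Z : Endofunctor.Coalgebra G) : Endofunctor.Coalgebra L.functor where
  V := (Kleisli.Adjunction.toKleisli T).obj Z.V
  str := (Kleisli.Adjunction.toKleisli T).map Z.str ≫ L.iso.inv.app Z.V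

/-- A `TG`-coalgebra as a coalgebra for the Kleisli lifting of `G`. -/
def ofTG (X : Endofunctor.Coalgebra (G ⋙ T.toFunctor)) : Endofunctor.Coalgebra L.functor where
  V := (Kleisli.Adjunction.toKleisli T).obj X.V
  str := (⟨X.str⟩ : Kleisli.Hom ((Kleisli.Adjunction.toKleisli T).obj X.V)
    ((Kleisli.Adjunction.toKleisli T).obj (G.obj X.V))) ≫ L.iso.inv.app X.V

/-- The final coalgebra of the lifting exists and is the image under `K` of the final `G`-coalgebra. -/
def CapturesInfiniteTraceSemantics : Prop :=
  ∃ (Z : Endofunctor.Coalgebra G) (W : Endofunctor.Coalgebra L.functor),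
    Nonempty (Limits.IsTerminal Z) ∧ Nonempty (Limits.IsTerminal W) ∧ Nonempty (W ≅ L.lift Z)

end KleisliLifting

section Embedding

variable {α : Ordinal.{w}} [HasWeakSheafify (alexandrov α) C]

/-- The canonical map from the constant sheaf at `F X` to the pointwise extension of `F` at the
constant sheaf at `X`. -/
noncomputable def constToExtP (F : C ⥤ C) (α : Ordinal.{w}) [HasWeakSheafify (alexandrov α) C]
    (X : C) : (constantSheaf (alexandrov α) C).obj (F.obj X) ⟶
      (extP F α).obj ((constantSheaf (alexandrov α) C).obj X) :=
  (presheafToSheaf (alexandrov α) C).map ((Functor.constComp (Stage α)ᵒᵖ X F).inv ≫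
    Functor.whiskerRight (toSheafify (alexandrov α) ((Functor.const _).obj X)) F)

/-- The guarded coalgebra on the constant sheaf at `X` of a `TF`-coalgebra `h : X ⟶ T F X`: the constant
sheaf functor at `h`, followed by the pointwise extension of `TF` at `next`. -/
noncomputable def guardedCoalgebra (T : Monad C) (F : C ⥤ C) (α : Ordinal.{w})
    [HasWeakSheafify (alexandrov α) C] (X : Endofunctor.Coalgebra (F ⋙ T.toFunctor)) :
    Endofunctor.Coalgebra (guarded F α ⋙ (extPMonad T α).toFunctor) where
  V := (constantSheaf (alexandrov α) C).obj X.V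
  str := (constantSheaf (alexandrov α) C).map X.str ≫
    constToExtP (F ⋙ T.toFunctor) α X.V ≫
    (extP (F ⋙ T.toFunctor) α).map ((next C α).app ((constantSheaf (alexandrov α) C).obj X.V)) ≫
    (extPComp T.toFunctor F α).inv.app ((later C α).obj ((constantSheaf (alexandrov α) C).obj X.V))

end Embedding

end GuardedTrace

open GuardedTrace

/-!
Successor stages are dense in `Stage α`, and the predecessor of a successor stage is strictly below
it. So a recursion that computes a section of a sheaf at each successor stage from its value at the
predecessor has exactly one solution, by well-founded induction on the stage. Applied to the sheaf
of local morphisms `presheafHom Z Y`, this shows that every coalgebra for a guarded pointwise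
extension has exactly one hylomorphism to every algebra.

Hence any isomorphism `W ≅ G W` is a final `G`-coalgebra. Kleisli coalgebra maps into `K W`
transpose along `K ⊣ U` to hylomorphisms of `T G`, and `T G` is again guarded, being the guarded
extension of `F ⋙ T`; so `K W` is final as well. Stability at `α` identifies the `F`-coalgebra maps
from `X` to `f(α)` with the solutions of a guarded recursion in the sheaf `Hom(X, f(-))`.
-/

namespace GuardedTrace

variable {C : Type u} [Category.{v} C]

section Amalgamation

variable {P : Type*} [Category P] {J : GrothendieckTopology P} {B : ObjectProperty P}
  [B.ι.IsCoverDense J]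

theorem eq_of_forall_map_eq {S : Pᵒᵖ ⥤ Type*} (hS : Presieve.IsSheaf J S) {s : P}
    {x y : S.obj (op s)}
    (h : ∀ (b : B.FullSubcategory) (f : b.obj ⟶ s), S.map f.op x = S.map f.op y) : x = y :=
  Functor.IsCoverDense.ext B.ι ⟨S, (isSheaf_iff_isSheaf_of_type J S).2 hS⟩ s h

theorem existsUnique_amalgamation {S : Pᵒᵖ ⥤ Type*} (hS : Presieve.IsSheaf J S) {s : P}
    (y : ∀ b : B.FullSubcategory, (b.obj ⟶ s) → S.obj (op b.obj))
    (hy : ∀ {b b' : B.FullSubcategory} (g : b.obj ⟶ b'.obj) (f : b'.obj ⟶ s),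
      S.map g.op (y b' f) = y b (g ≫ f)) :
    ∃! x : S.obj (op s), ∀ b f, S.map f.op x = y b f := by
  let R : Presieve s := fun r _ => B r
  have hR : Sieve.generate R ∈ J s := by
    refine J.superset_covering ?_ (Functor.is_cover_of_isCoverDense B.ι J s)
    rintro r _ ⟨⟨b, g, f, rfl⟩⟩
    exact ⟨_, g, f, b.property, rfl⟩
  obtain ⟨x, hx, hx_unique⟩ := (Presieve.isSheafFor_iff_generate R).2 (hS _ hR)
    (fun r f hr => y ⟨r, hr⟩ f) (by
      intro r₁ r₂ q g₁ g₂ f₁ f₂ h₁ h₂ hg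
      refine eq_of_forall_map_eq (B := B) hS fun b k => ?_
      rw [← Functor.map_comp_apply, ← Functor.map_comp_apply, ← op_comp, ← op_comp,
        hy (b' := ⟨r₁, h₁⟩), hy (b' := ⟨r₂, h₂⟩), Category.assoc, Category.assoc, hg])
  exact ⟨x, fun b f => hx f b.property, fun x' h => hx_unique x' fun r f hr => h ⟨r, hr⟩ f⟩

end Amalgamation

section Recursion

variable {P : Type*} [Preorder P] {J : GrothendieckTopology P} {B : ObjectProperty P}
  {p : P ⥤ P} {S : Pᵒᵖ ⥤ Type*} (step : B.ι.op ⋙ p.op ⋙ S ⟶ B.ι.op ⋙ S)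

/-- A guarded fixpoint of a recursion `step`, which computes the value of a section at a stage
`b ∈ B` from its value at the stage `p b`: a local section over `s` that satisfies the recursion at
every `b ⟶ s` for which `p b` also lies below `s`. -/
def IsGuardedFixpoint {s : P} (x : S.obj (op s)) : Prop :=
  ∀ (b : B.FullSubcategory) (f : b.obj ⟶ s) (g : p.obj b.obj ⟶ s),
    S.map f.op x = step.app (op b) (S.map g.op x)

variable {step}

theorem IsGuardedFixpoint.map {r s : P} {x : S.obj (op s)} (hx : IsGuardedFixpoint step x)
    (h : r ⟶ s) : IsGuardedFixpoint step (S.map h.op x) := fun b f g => by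
  rw [← Functor.map_comp_apply, ← Functor.map_comp_apply, ← op_comp, ← op_comp]
  exact hx b (f ≫ h) (g ≫ h)

variable [WellFoundedLT P] [B.ι.IsCoverDense J]

variable (step) in
theorem existsUnique_isGuardedFixpoint (hp : ∀ b : B.FullSubcategory, p.obj b.obj < b.obj)
    (hS : Presieve.IsSheaf J S) (s : P) : ∃! x : S.obj (op s), IsGuardedFixpoint step x := by
  induction s using WellFoundedLT.induction with
  | ind s ih =>
    choose x hx hx_unique using ih
    have hlt {r : P} (b : B.FullSubcategory) (f : b.obj ⟶ r) : p.obj b.obj < r :=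
      (hp b).trans_le (leOfHom f)
    have hmap {r r' : P} (hr' : r' < s) (g : r ⟶ r') :
        S.map g.op (x r' hr') = x r ((leOfHom g).trans_lt hr') :=
      hx_unique _ _ _ ((hx r' hr').map g)
    obtain ⟨z, hz, hz_unique⟩ := existsUnique_amalgamation (B := B) hS
      (fun b (f : b.obj ⟶ s) => step.app (op b) (x (p.obj b.obj) (hlt b f))) (by
        intro b b' g f
        refine (NatTrans.naturality_apply step (ObjectProperty.homMk g).op _).symm.trans ?_
        exact congrArg (step.app (op b)) (hmap _ (p.map g)))
    have hz_lt {r : P} (hr : r < s) (g : r ⟶ s) : S.map g.op z = x r hr := by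
      refine eq_of_forall_map_eq (B := B) hS fun b f => ?_
      rw [← Functor.map_comp_apply, ← op_comp, hz, hx r hr b f (homOfLE (hlt b f).le), hmap]
    refine ⟨z, fun b f g => ?_, fun z' hz' => hz_unique z' fun b f => ?_⟩
    · rw [hz, hz_lt (hlt b f)]
    · rw [hz' b f (homOfLE (hlt b f).le), hx_unique _ (hlt b f) _ (hz'.map _)]

variable (step) in
theorem existsUnique_section_isGuardedFixpoint (hp : ∀ b : B.FullSubcategory, p.obj b.obj < b.obj)
    (hS : Presieve.IsSheaf J S) :
    ∃! x : S.sections, ∀ s, IsGuardedFixpoint step (x.1 (op s)) := by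
  choose x hx hx_unique using existsUnique_isGuardedFixpoint step hp hS
  refine ⟨⟨fun s => x s.unop, fun f => hx_unique _ _ ((hx _).map f.unop)⟩, hx, fun y hy => ?_⟩
  exact Subtype.ext (funext fun s => hx_unique _ _ (hy s.unop))

end Recursion

section LocalHom

variable {P : Type*} [Category P] {J : GrothendieckTopology P} {B : ObjectProperty P}
  [B.ι.IsCoverDense J] {Z Y : Pᵒᵖ ⥤ C}

theorem hom_ext_of_isSheaf (hY : Presheaf.IsSheaf J Y) {A : C} {s : P} {k k' : A ⟶ Y.obj (op s)}
    (h : ∀ (b : B.FullSubcategory) (f : b.obj ⟶ s), k ≫ Y.map f.op = k' ≫ Y.map f.op) : k = k' :=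
  eq_of_forall_map_eq (B := B) (hY A) h

theorem natTrans_ext_of_isSheaf (hY : Presheaf.IsSheaf J Y) {f g : Z ⟶ Y}
    (h : ∀ b : B.FullSubcategory, f.app (op b.obj) = g.app (op b.obj)) : f = g := by
  ext s
  refine hom_ext_of_isSheaf (B := B) hY fun b k => ?_
  rw [← f.naturality, ← g.naturality, h]

theorem existsUnique_lift_of_isSheaf (hY : Presheaf.IsSheaf J Y) {A : C} {s : P}
    (y : ∀ b : B.FullSubcategory, (b.obj ⟶ s) → (A ⟶ Y.obj (op b.obj)))
    (hy : ∀ {b b' : B.FullSubcategory} (g : b.obj ⟶ b'.obj) (f : b'.obj ⟶ s),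
      y b' f ≫ Y.map g.op = y b (g ≫ f)) :
    ∃! x : A ⟶ Y.obj (op s), ∀ b f, x ≫ Y.map f.op = y b f :=
  existsUnique_amalgamation (hY A) y hy

theorem presheafHom_naturality {s r r' : P} (φ : (presheafHom Z Y).obj (op s)) (k : r' ⟶ r)
    (g : r ⟶ s) : φ.app (op (Over.mk g)) ≫ Y.map k.op =
      Z.map k.op ≫ φ.app (op (Over.mk (k ≫ g))) :=
  (φ.naturality (Over.homMk k : Over.mk (k ≫ g) ⟶ Over.mk g).op).symm

theorem existsUnique_presheafHom (hY : Presheaf.IsSheaf J Y) {s : P}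
    (y : ∀ b : B.FullSubcategory, (b.obj ⟶ s) → (Z.obj (op b.obj) ⟶ Y.obj (op b.obj)))
    (hy : ∀ {b b' : B.FullSubcategory} (g : b.obj ⟶ b'.obj) (f : b'.obj ⟶ s),
      y b' f ≫ Y.map g.op = Z.map g.op ≫ y b (g ≫ f)) :
    ∃! φ : (presheafHom Z Y).obj (op s), ∀ b f, φ.app (op (Over.mk f)) = y b f := by
  choose φ hφ hφ_unique using fun (r : P) (g : r ⟶ s) => existsUnique_lift_of_isSheaf hY
    (fun (b : B.FullSubcategory) (f : b.obj ⟶ r) => Z.map f.op ≫ y b (f ≫ g))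
    (fun {b b'} k f => by
      rw [Category.assoc, hy, ← Z.map_comp_assoc, Category.assoc, op_comp])
  have hφ_map {r r' : P} (k : r' ⟶ r) (g : r ⟶ s) :
      φ r g ≫ Y.map k.op = Z.map k.op ≫ φ r' (k ≫ g) := by
    refine hom_ext_of_isSheaf (B := B) hY fun b f => ?_
    rw [Category.assoc, Category.assoc, hφ, ← Y.map_comp, ← op_comp, hφ, op_comp,
      Z.map_comp_assoc, Category.assoc]
  refine ⟨{ app r := φ r.unop.left r.unop.hom, naturality r r' k := ?_ }, fun b f => ?_,
    fun ψ hψ => NatTrans.ext (funext fun r => hφ_unique _ _ _ fun b f => ?_)⟩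
  · rw [← Over.w k.unop]
    exact (hφ_map k.unop.left r.unop.hom).symm
  · refine (hφ_unique b.obj f _ fun b' f' => hy f' f).symm
  · rw [← hψ]
    exact presheafHom_naturality ψ f r.unop.hom

theorem existsUnique_presheafHom_step {p : P ⥤ P} {E : C ⥤ C} (hY : Presheaf.IsSheaf J Y)
    (c : B.ι.op ⋙ Z ⟶ B.ι.op ⋙ p.op ⋙ Z ⋙ E) (m : B.ι.op ⋙ p.op ⋙ Y ⋙ E ⟶ B.ι.op ⋙ Y)
    {s : P} (x : (presheafHom Z Y).obj (op (p.obj s))) :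
    ∃! φ : (presheafHom Z Y).obj (op s), ∀ (b : B.FullSubcategory) (f : b.obj ⟶ s),
      φ.app (op (Over.mk f)) =
        c.app (op b) ≫ E.map (x.app (op (Over.mk (p.map f)))) ≫ m.app (op b) := by
  refine existsUnique_presheafHom hY _ fun {b b'} g f => ?_
  have hc := c.naturality (ObjectProperty.homMk g : b ⟶ b').op
  have hm := m.naturality (ObjectProperty.homMk g : b ⟶ b').op
  have hx : E.map (x.app (op (Over.mk (p.map f)))) ≫ E.map (Y.map (p.map g).op) =
      E.map (Z.map (p.map g).op) ≫ E.map (x.app (op (Over.mk (p.map (g ≫ f))))) := by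
    rw [p.map_comp, ← E.map_comp]
    exact (congrArg E.map (presheafHom_naturality x (p.map g) (p.map f))).trans
      (E.map_comp _ _)
  dsimp at hc hm hx ⊢
  rw [reassoc_of% hc, ← reassoc_of% hx, hm, Category.assoc, Category.assoc]

end LocalHom

section RecursionHom

variable {P : Type*} [Preorder P] {J : GrothendieckTopology P} {B : ObjectProperty P}
  [B.ι.IsCoverDense J] {p : P ⥤ P} {Z Y : Pᵒᵖ ⥤ C} {E : C ⥤ C}

theorem existsUnique_hom_of_guarded [WellFoundedLT P]
    (hp : ∀ b : B.FullSubcategory, p.obj b.obj < b.obj)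
    (hY : Presheaf.IsSheaf J Y) (c : B.ι.op ⋙ Z ⟶ B.ι.op ⋙ p.op ⋙ Z ⋙ E)
    (m : B.ι.op ⋙ p.op ⋙ Y ⋙ E ⟶ B.ι.op ⋙ Y) :
    ∃! h : Z ⟶ Y, ∀ b : B.FullSubcategory, h.app (op b.obj) =
      c.app (op b) ≫ E.map (h.app (op (p.obj b.obj))) ≫ m.app (op b) := by
  choose σ hσ hσ_unique using fun s => existsUnique_presheafHom_step hY c m (s := s)
  let step : B.ι.op ⋙ p.op ⋙ presheafHom Z Y ⟶ B.ι.op ⋙ presheafHom Z Y :=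
    { app b := ↾σ b.unop.obj
      naturality b b' g := by
        ext x
        exact (hσ_unique _ _ _ fun b f => hσ _ x b (f ≫ g.unop.hom)).symm }
  refine ((presheafHomSectionsEquiv Z Y).symm.existsUnique_congr fun {h} => ?_).2
    (existsUnique_section_isGuardedFixpoint step hp
      ((isSheaf_iff_isSheaf_of_type J _).1 (Presheaf.IsSheaf.hom Z Y hY)))
  refine ⟨fun hh s b f g => hσ_unique _ _ _ fun b' _ => hh b', fun hh b => ?_⟩
  exact (congrArg (fun φ => φ.app (op (Over.mk (𝟙 b.obj)))) (hh b.obj b (𝟙 _)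
    (homOfLE (hp b).le))).trans (hσ _ _ b (𝟙 _))

end RecursionHom

section Hylomorphism

variable {D : Type*} [Category D]

/-- Every `H`-coalgebra is recursive: it has exactly one coalgebra-to-algebra morphism, or
hylomorphism, to each `H`-algebra. -/
def HasUniqueHylomorphisms (H : D ⥤ D) : Prop :=
  ∀ ⦃Z Y : D⦄ (c : Z ⟶ H.obj Z) (m : H.obj Y ⟶ Y), ∃! h : Z ⟶ Y, h = c ≫ H.map h ≫ m

theorem HasUniqueHylomorphisms.of_iso {H H' : D ⥤ D} (hH : HasUniqueHylomorphisms H)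
    (e : H ≅ H') : HasUniqueHylomorphisms H' := fun _ _ c m => by
  simpa using hH (c ≫ e.inv.app _) (e.hom.app _ ≫ m)

theorem nonempty_isTerminal_coalgebra {H : D ⥤ D} (W : Endofunctor.Coalgebra H)
    (h : ∀ {Z : D} (d : Z ⟶ H.obj Z), ∃! f : Z ⟶ W.V, d ≫ H.map f = f ≫ W.str) :
    Nonempty (Limits.IsTerminal W) := by
  choose f hf hf_unique using fun Z : Endofunctor.Coalgebra H => h Z.str
  exact ⟨Limits.IsTerminal.ofUniqueHom (fun Z => ⟨f Z, hf Z⟩)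
    fun Z g => Endofunctor.Coalgebra.Hom.ext (hf_unique Z g.f g.h)⟩

theorem HasUniqueHylomorphisms.nonempty_isTerminal {H : D ⥤ D} (hH : HasUniqueHylomorphisms H)
    {W : D} (c : W ≅ H.obj W) :
    Nonempty (Limits.IsTerminal (⟨W, c.hom⟩ : Endofunctor.Coalgebra H)) :=
  nonempty_isTerminal_coalgebra _ fun d => (existsUnique_congr fun f => by
    change d ≫ H.map f = f ≫ c.hom ↔ _
    rw [← Iso.comp_inv_eq, Category.assoc, eq_comm]).2 (hH d c.inv)

variable {A : Type*} [Category A] {K : D ⥤ A} {U : A ⥤ D} {G : D ⥤ D} {G' : A ⥤ A}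

theorem map_eq_of_adjunction (adj : K ⊣ U) (i : K ⋙ G' ≅ G ⋙ K) {X W : D}
    (f : K.obj X ⟶ K.obj W) : G'.map f =
      i.hom.app X ≫ K.map (G.map (adj.homEquiv _ _ f)) ≫ i.inv.app _ ≫
        G'.map (adj.counit.app (K.obj W)) := by
  have hi := NatIso.naturality_2 i (adj.homEquiv _ _ f)
  have hf : K.map (adj.homEquiv _ _ f) ≫ adj.counit.app (K.obj W) = f :=
    (adj.homEquiv_counit _ _ _).symm.trans (Equiv.symm_apply_apply _ f)
  dsimp at hi
  rw [reassoc_of% hi, ← G'.map_comp, hf]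

theorem HasUniqueHylomorphisms.existsUnique_lift (hH : HasUniqueHylomorphisms (G ⋙ K ⋙ U))
    (adj : K ⊣ U) (i : K ⋙ G' ≅ G ⋙ K) {X W : D} (c : W ≅ G.obj W)
    (d : K.obj X ⟶ G'.obj (K.obj X)) :
    ∃! f : K.obj X ⟶ K.obj W, d ≫ G'.map f = f ≫ K.map c.hom ≫ i.inv.app W := by
  let m := i.inv.app _ ≫ G'.map (adj.counit.app (K.obj W)) ≫ i.hom.app W ≫ K.map c.inv
  refine ((adj.homEquiv X (K.obj W)).existsUnique_congr fun {f} => ?_).2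
    (hH (adj.homEquiv _ _ (d ≫ i.hom.app X)) (U.map m))
  have hf : d ≫ G'.map f = f ≫ K.map c.hom ≫ i.inv.app W ↔
      f = (d ≫ i.hom.app X) ≫ K.map (G.map (adj.homEquiv _ _ f)) ≫ m := by
    change d ≫ G'.map f = f ≫ (K.mapIso c ≪≫ (i.app W).symm).hom ↔ _
    rw [map_eq_of_adjunction adj i f, ← Iso.comp_inv_eq, eq_comm]
    simp [m]
  rw [hf, ← (adj.homEquiv X (K.obj W)).apply_eq_iff_eq, adj.homEquiv_naturality_right,
    U.map_comp]
  rfl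

end Hylomorphism

theorem KleisliLifting.nonempty_isTerminal_lift {D : Type*} [Category D] {T : Monad D} {G : D ⥤ D}
    (L : KleisliLifting T G) (hG : HasUniqueHylomorphisms (G ⋙ T.toFunctor)) {W : D}
    (c : W ≅ G.obj W) : Nonempty (Limits.IsTerminal (L.lift ⟨W, c.hom⟩)) :=
  nonempty_isTerminal_coalgebra _ fun d =>
    (hG.of_iso (Functor.isoWhiskerLeft G
      (Kleisli.Adjunction.toKleisliCompFromKleisliIsoSelf T).symm)).existsUnique_lift
        (Kleisli.Adjunction.adj T) L.iso c d

section Guarded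

variable {α : Ordinal.{w}}

theorem predecessor_add_one {t : Stage α} (ht : IsSuccStage α t) :
    (predecessor α t).1 + 1 = t.1 := by
  obtain ⟨t, h⟩ := t
  obtain ⟨β, rfl : t = β + 1⟩ := ht
  exact congrArg (· + 1) (predecessor_succ (Set.mem_Iic.1 h))

theorem predecessor_lt {t : Stage α} (ht : IsSuccStage α t) : predecessor α t < t :=
  Subtype.coe_lt_coe.1 ((Order.lt_add_one_iff.2 le_rfl).trans_eq (predecessor_add_one ht))

variable [HasWeakSheafify (alexandrov α) C] (E : C ⥤ C)

theorem isIso_guardedUnit_app (X : Sh C α) {t : Stage α} (ht : IsSuccStage α t) :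
    IsIso ((guardedUnit E X).app (op t)) :=
  have := isIso_toSheafify_app ((predecessor α).monotone.functor.op ⋙ X.obj) ht
  have := isIso_toSheafify_app (((later C α).obj X).obj ⋙ E) ht
  IsIso.comp_isIso' (inferInstanceAs (IsIso (E.map ((toSheafify _ _).app (op t))))) this

theorem guardedUnit_naturality {X Y : Sh C α} (f : X ⟶ Y) :
    Functor.whiskerRight (Functor.whiskerLeft (predecessor α).monotone.functor.op f.hom) E ≫
      guardedUnit E Y = guardedUnit E X ≫ ((guarded E α).map f).hom := by
  let f' := Functor.whiskerLeft (predecessor α).monotone.functor.op f.hom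
  change Functor.whiskerRight f' E ≫ Functor.whiskerRight (toSheafify (alexandrov α) _) E ≫
    toSheafify (alexandrov α) _ = (Functor.whiskerRight (toSheafify (alexandrov α) _) E ≫
      toSheafify (alexandrov α) _) ≫
        sheafifyMap (alexandrov α) (Functor.whiskerRight (sheafifyMap (alexandrov α) f') E)
  rw [Category.assoc, ← toSheafify_naturality, ← Category.assoc,
    ← Category.assoc, ← Functor.whiskerRight_comp, ← Functor.whiskerRight_comp,
    toSheafify_naturality (alexandrov α) f']

/-- The restriction of `guardedUnit` to the successor stages, where it is invertible. -/
noncomputable def guardedUnitIso (X : Sh C α) :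
    (IsSuccStage α).ι.op ⋙ (predecessor α).monotone.functor.op ⋙ X.obj ⋙ E ≅
      (IsSuccStage α).ι.op ⋙ ((guarded E α).obj X).obj :=
  NatIso.ofComponents
    (fun t => have := isIso_guardedUnit_app E X t.unop.property
      asIso ((guardedUnit E X).app (op t.unop.obj)))
    fun f => (guardedUnit E X).naturality ((IsSuccStage α).ι.op.map f)

theorem guarded_map_app {X Y : Sh C α} (f : X ⟶ Y) (t : (IsSuccStage α).FullSubcategory) :
    ((guarded E α).map f).hom.app (op t.obj) = (guardedUnitIso E X).inv.app (op t) ≫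
      E.map (f.hom.app (op (predecessor α t.obj))) ≫ (guardedUnitIso E Y).hom.app (op t) :=
  ((guardedUnitIso E X).app (op t)).eq_inv_comp.2
    (congr_app (guardedUnit_naturality E f) (op t.obj)).symm

theorem hasUniqueHylomorphisms_guarded : HasUniqueHylomorphisms (guarded E α) := by
  intro Z Y c m
  refine ((fullyFaithfulSheafToPresheaf (alexandrov α) C).homEquiv.existsUnique_congr
    fun {h} => ?_).2 (existsUnique_hom_of_guarded (B := IsSuccStage α) (E := E)
      (p := (predecessor α).monotone.functor)
      (fun t => predecessor_lt t.property) Y.property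
      (Functor.whiskerLeft _ c.hom ≫ (guardedUnitIso E Z).inv)
      ((guardedUnitIso E Y).hom ≫ Functor.whiskerLeft _ m.hom))
  have happ (t : (IsSuccStage α).FullSubcategory) :
      (c ≫ (guarded E α).map h ≫ m).hom.app (op t.obj) =
        (c.hom.app (op t.obj) ≫ (guardedUnitIso E Z).inv.app (op t)) ≫
          E.map (h.hom.app (op (predecessor α t.obj))) ≫
            (guardedUnitIso E Y).hom.app (op t) ≫ m.hom.app (op t.obj) := by
    change c.hom.app (op t.obj) ≫ ((guarded E α).map h).hom.app (op t.obj) ≫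
      m.hom.app (op t.obj) = _
    rw [guarded_map_app, Category.assoc, Category.assoc]
    exact congrArg (fun k => c.hom.app _ ≫ (guardedUnitIso E Z).inv.app _ ≫ k)
      (Category.assoc _ _ _)
  exact ⟨fun hh t => (congrArg (fun k : Z ⟶ Y => k.hom.app (op t.obj)) hh).trans (happ t),
    fun hh => ObjectProperty.hom_ext _ (natTrans_ext_of_isSheaf (B := IsSuccStage α) Y.property
      fun t => (hh t).trans (happ t).symm)⟩

end Guarded

/-- The global sections of a sheaf on `Stage α` are its sections over the top stage `α`. -/
noncomputable def globalSectionsIso {α : Ordinal.{w}} [HasWeakSheafify (alexandrov α) C]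
    [HasGlobalSectionsFunctor (alexandrov α) C] (X : Sh C α) :
    (Sheaf.Γ (alexandrov α) C).obj X ≅ X.obj.obj (op ⟨α, Set.mem_Iic.2 le_rfl⟩) :=
  have top_isTerminal : Limits.IsTerminal (⟨α, Set.mem_Iic.2 le_rfl⟩ : Stage α) :=
    Limits.IsTerminal.ofUniqueHom (fun s => homOfLE s.2) fun _ _ => Subsingleton.elim _ _
  have := top_isTerminal.hasTerminal
  (Sheaf.ΓNatIsoSheafSections (alexandrov α) C top_isTerminal).app X

namespace FinalSequence

variable {F : C ⥤ C} (Φ : FinalSequence.{w} F)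

/-- The identification `succIso`, transported along an equality so that it applies to the
predecessor of a successor stage. -/
noncomputable def isoOfAddOneEq {β : Ordinal.{w}} :
    {γ : Ordinal.{w}} → β + 1 = γ → (Φ.seq.obj (op γ) ≅ F.obj (Φ.seq.obj (op β)))
  | _, rfl => Φ.succIso β

theorem isoOfAddOneEq_naturality {β β' γ γ' : Ordinal.{w}} (h : β + 1 = γ) (h' : β' + 1 = γ')
    (hβ : β ≤ β') (hγ : γ ≤ γ') :
    Φ.seq.map (homOfLE hγ).op ≫ (Φ.isoOfAddOneEq h).hom =
      (Φ.isoOfAddOneEq h').hom ≫ F.map (Φ.seq.map (homOfLE hβ).op) := by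
  subst h h'
  exact Φ.succIso_naturality hβ hγ

theorem isoOfAddOneEq_inv_naturality {β β' γ γ' : Ordinal.{w}} (h : β + 1 = γ) (h' : β' + 1 = γ')
    (hβ : β ≤ β') (hγ : γ ≤ γ') :
    (Φ.isoOfAddOneEq h').inv ≫ Φ.seq.map (homOfLE hγ).op =
      F.map (Φ.seq.map (homOfLE hβ).op) ≫ (Φ.isoOfAddOneEq h).inv := by
  rw [Iso.inv_comp_eq, ← Category.assoc, Iso.eq_comp_inv, isoOfAddOneEq_naturality]

/-- The values of a final sequence at the successor stages are `F` of its values at their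
predecessors. -/
noncomputable def predecessorIso (α : Ordinal.{w}) :
    (IsSuccStage α).ι.op ⋙ (Φ.sheaf α).obj ≅
      (IsSuccStage α).ι.op ⋙ (predecessor α).monotone.functor.op ⋙ (Φ.sheaf α).obj ⋙ F :=
  NatIso.ofComponents (fun t => Φ.isoOfAddOneEq (predecessor_add_one t.unop.property))
    fun f => Φ.isoOfAddOneEq_naturality _ _ ((predecessor α).monotone (leOfHom f.unop.hom)) _

theorem predecessorIso_hom_app_eq_stageStr {α β : Ordinal.{w}} (h : β + 1 ≤ α) :
    (Φ.predecessorIso α).hom.app (op ⟨⟨β + 1, h⟩, β, rfl⟩) = Φ.stageStr α β h := by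
  have h' := Φ.isoOfAddOneEq_naturality (predecessor_add_one (t := ⟨β + 1, h⟩) ⟨β, rfl⟩) rfl
    (predecessor_succ h).le le_rfl
  exact ((congrArg (· ≫ _) (Φ.seq.map_id _)).trans (Category.id_comp _)).symm.trans h'

/-- The isomorphism between the sheaf of a final sequence and its guarded pointwise extension. -/
noncomputable def guardedIso (α : Ordinal.{w}) [HasWeakSheafify (alexandrov α) C] :
    Φ.sheaf α ≅ (guarded F α).obj (Φ.sheaf α) :=
  Functor.IsCoverDense.sheafIso (G := (IsSuccStage α).ι)
    (Φ.predecessorIso α ≪≫ guardedUnitIso F (Φ.sheaf α))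

theorem guardedIso_hom_app {α : Ordinal.{w}} [HasWeakSheafify (alexandrov α) C]
    (t : (IsSuccStage α).FullSubcategory) :
    (Φ.guardedIso α).hom.hom.app (op t.obj) =
      (Φ.predecessorIso α).hom.app (op t) ≫ (guardedUnit F (Φ.sheaf α)).app (op t.obj) :=
  congr_app (Functor.IsCoverDense.sheafHom_restrict_eq (G := (IsSuccStage α).ι)
    (ℱ := (Φ.sheaf α).obj) (ℱ' := (guarded F α).obj (Φ.sheaf α)) _) (op t)

/-- The recursion whose solutions are the maps from the carrier of the coalgebra `d` into the final
sequence that are compatible with `d`. -/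
noncomputable def coalgebraStep (α : Ordinal.{w}) {X : C} (d : X ⟶ F.obj X) :
    (IsSuccStage α).ι.op ⋙ (predecessor α).monotone.functor.op ⋙
        (Φ.sheaf α).obj ⋙ coyoneda.obj (op X) ⟶
      (IsSuccStage α).ι.op ⋙ (Φ.sheaf α).obj ⋙ coyoneda.obj (op X) :=
  let post : coyoneda.obj (op X) ⟶ F ⋙ coyoneda.obj (op X) := { app Y := ↾fun k => d ≫ F.map k }
  Functor.whiskerLeft ((IsSuccStage α).ι.op ⋙ (predecessor α).monotone.functor.op ⋙
    (Φ.sheaf α).obj) post ≫ Functor.whiskerRight (Φ.predecessorIso α).inv (coyoneda.obj (op X))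

theorem isGuardedFixpoint_coalgebraStep_iff {α : Ordinal.{w}} (hα : Φ.IsStableAt α) {X : C}
    (d : X ⟶ F.obj X) (k : X ⟶ Φ.seq.obj (op α)) :
    IsGuardedFixpoint (Φ.coalgebraStep α d) (s := ⟨α, Set.mem_Iic.2 le_rfl⟩) k ↔
      d ≫ F.map k = k ≫ (Φ.coalgebra α hα).str := by
  have : IsIso (Φ.seq.map (homOfLE (le_add_one α)).op) := hα
  have hk : d ≫ F.map k = k ≫ (Φ.coalgebra α hα).str ↔
      k = d ≫ F.map k ≫ (Φ.succIso α).inv ≫ Φ.seq.map (homOfLE (le_add_one α)).op := by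
    change d ≫ F.map k = k ≫ inv (Φ.seq.map (homOfLE (le_add_one α)).op) ≫
      (Φ.succIso α).hom ↔ _
    rw [← Category.assoc k, ← Iso.comp_inv_eq, IsIso.eq_comp_inv, Category.assoc, Category.assoc,
      eq_comm]
  have hstage (t : (IsSuccStage α).FullSubcategory) :
      (d ≫ F.map k ≫ (Φ.succIso α).inv ≫ Φ.seq.map (homOfLE (le_add_one α)).op) ≫
          Φ.seq.map (homOfLE (Set.mem_Iic.1 t.obj.2)).op =
        (Φ.coalgebraStep α d).app (op t)
          (k ≫ Φ.seq.map (homOfLE (Set.mem_Iic.1 (predecessor α t.obj).2)).op) := by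
    change _ = (d ≫ F.map (k ≫ Φ.seq.map (homOfLE _).op)) ≫
      (Φ.isoOfAddOneEq (predecessor_add_one t.property)).inv
    rw [F.map_comp]
    simp only [Category.assoc]
    rw [← Φ.isoOfAddOneEq_inv_naturality _ rfl _
      ((Set.mem_Iic.1 t.obj.2).trans (le_add_one α)), ← Φ.seq.map_comp]
    rfl
  rw [hk]
  refine ⟨fun h => ?_, fun h t f g => ?_⟩
  · exact hom_ext_of_isSheaf (B := IsSuccStage α) (Φ.isSheaf_restrict α) fun t f =>
      (h t f (homOfLE (predecessor α t.obj).2)).trans (hstage t).symm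
  · exact (congrArg (· ≫ _) h).trans (hstage t)

theorem existsUnique_coalgebraHom {α : Ordinal.{w}} (hα : Φ.IsStableAt α) {X : C}
    (d : X ⟶ F.obj X) :
    ∃! k : X ⟶ Φ.seq.obj (op α), d ≫ F.map k = k ≫ (Φ.coalgebra α hα).str :=
  (existsUnique_congr fun k => Φ.isGuardedFixpoint_coalgebraStep_iff hα d k).1
    (existsUnique_isGuardedFixpoint (Φ.coalgebraStep α d) (fun t => predecessor_lt t.property)
      (Φ.isSheaf_restrict α X) ⟨α, Set.mem_Iic.2 le_rfl⟩)

end FinalSequence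

end GuardedTrace

theorem mainTheorem1 {C : Type u} [Category.{v} C] (T : Monad C) (F : C ⥤ C) (α : Ordinal.{w})
    [HasWeakSheafify (alexandrov α) C] [HasGlobalSectionsFunctor (alexandrov α) C]
    (Φ : FinalSequence.{w} F) (hΦ : Φ.IsStableAt α)
    (L : KleisliLifting (extPMonad T α) (guarded F α)) :
    ∃ c : Φ.sheaf α ≅ (guarded F α).obj (Φ.sheaf α),
      (∀ (β : Ordinal.{w}) (h : β + 1 ≤ α), c.hom.hom.app (op ⟨β + 1, h⟩) =
        Φ.stageStr α β h ≫ (guardedUnit F (Φ.sheaf α)).app (op ⟨β + 1, h⟩)) ∧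
      Nonempty (Limits.IsTerminal (⟨Φ.sheaf α, c.hom⟩ : Endofunctor.Coalgebra (guarded F α))) ∧
      Nonempty (Limits.IsTerminal (L.lift ⟨Φ.sheaf α, c.hom⟩)) ∧
      L.CapturesInfiniteTraceSemantics ∧
      Nonempty (Limits.IsTerminal (Φ.coalgebra α hΦ)) ∧
      Nonempty ((Sheaf.Γ (alexandrov α) C).obj (Φ.sheaf α) ≅ (Φ.coalgebra α hΦ).V) ∧
      ∀ X : Endofunctor.Coalgebra (F ⋙ T.toFunctor),
        Nonempty (Unique (L.ofTG (guardedCoalgebra T F α X) ⟶ L.lift ⟨Φ.sheaf α, c.hom⟩)) := by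
  obtain ⟨hG⟩ := (hasUniqueHylomorphisms_guarded F).nonempty_isTerminal (Φ.guardedIso α)
  have hTG : HasUniqueHylomorphisms (guarded F α ⋙ (extPMonad T α).toFunctor) :=
    (hasUniqueHylomorphisms_guarded (F ⋙ T.toFunctor)).of_iso
      (Functor.isoWhiskerLeft (later C α) (extPComp T.toFunctor F α)).symm
  obtain ⟨hL⟩ := L.nonempty_isTerminal_lift hTG (Φ.guardedIso α)
  refine ⟨Φ.guardedIso α, fun β h => ?_, ⟨hG⟩, ⟨hL⟩, ⟨_, _, ⟨hG⟩, ⟨hL⟩, ⟨Iso.refl _⟩⟩,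
    nonempty_isTerminal_coalgebra _ fun d => Φ.existsUnique_coalgebraHom hΦ d,
    ⟨globalSectionsIso (Φ.sheaf α)⟩, fun X => ⟨⟨hL.from _⟩, fun _ => hL.hom_ext _ _⟩⟩
  rw [← Φ.predecessorIso_hom_app_eq_stageStr h]
  exact Φ.guardedIso_hom_app ⟨⟨β + 1, h⟩, β, rfl⟩
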